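/- Let $n\ge 1$, let $s\in(0,1)$, and let $\Omega\subseteq\mathbb{R}^n$ be a bounded open set with boundary of class $C^1$. Let $$\mathbb{X}(\Omega):=\{u\in H^1(\mathbb{R}^n): u=0\ \text{a.e. on }\mathbb{R}^n\setminus\Omega\},$$ and, for $u\in\mathbb{X}(\Omega)$, let $$\mathcal{D}_{\Omega,s}(u):=\int_\Omega|\nabla u|^2\,dx+\iint_{\mathbb{R}^{2n}}\frac{|u(x)-u(y)|^2}{|x-y|^{n+2s}}\,dx\,dy .$$ Let $$\lambda_{\mathcal L}(\Omega):=\inf\Big\{\frac{\mathcal{D}_{\Omega,s}(u)}{\|u\|_{L^2(\Omega)}^2}: u\in\mathbb{X}(\Omega)\setminus\{0\}\Big\}$$ be the principal Dirichlet eigenvalue of $\mathcal{L}=-\Delta+(-\Delta)^s$ in $\Omega$. Let $u_0$ be the principal eigenfunction of $\mathcal{L}$ in $\Omega$, that is, $u_0\in\mathbb{X}(\Omega)$, $\|u_0\|_{L^2(\Omega)}=1$, $\mathcal{D}_{\Omega,s}(u_0)=\lambda_{\mathcal L}(\Omega)$, and $u_0\ge 0$ a.e. in $\Omega$. Then $u_0$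 is globally bounded on $\Omega$, i.e. $u_0\in L^\infty(\Omega)$. -/

import Mathlib

open MeasureTheory
open scoped ENNReal ContDiff

noncomputable section

namespace MixedOperator

/-- `Ω` has boundary of class `C¹`: near each boundary point, `Ω` is the strict sublevel set `{ρ < 0}`
of a `C¹` function `ρ` whose differential does not vanish at that point. -/
def HasC1Boundary {n : ℕ} (Ω : Set (EuclideanSpace ℝ (Fin n))) : Prop :=
  ∀ p ∈ frontier Ω, ∃ (U : Set (EuclideanSpace ℝ (Fin n))) (ρ : EuclideanSpace ℝ (Fin n) → ℝ),
    IsOpen U ∧ p ∈ U ∧ ContDiffOn ℝ 1 ρ U ∧ fderiv ℝ ρ p ≠ 0 ∧ Ω ∩ U = {x ∈ U | ρ x < 0}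

/-- `G` is a weak (distributional) gradient of `u` on `ℝⁿ`. -/
def IsWeakGradient {n : ℕ} (u : EuclideanSpace ℝ (Fin n) → ℝ)
    (G : EuclideanSpace ℝ (Fin n) → EuclideanSpace ℝ (Fin n)) : Prop :=
  LocallyIntegrable u volume ∧ LocallyIntegrable G volume ∧
    ∀ φ : EuclideanSpace ℝ (Fin n) → ℝ, ContDiff ℝ ∞ φ → HasCompactSupport φ →
      ∀ e : EuclideanSpace ℝ (Fin n),
        ∫ x, u x * fderiv ℝ φ x e = -∫ x, inner ℝ (G x) e * φ x

/-- `u ∈ H¹(ℝⁿ)`: both `u` and its weak gradient are square integrable. -/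
def MemH1 {n : ℕ} (u : EuclideanSpace ℝ (Fin n) → ℝ) : Prop :=
  MemLp u 2 volume ∧
    ∃ G : EuclideanSpace ℝ (Fin n) → EuclideanSpace ℝ (Fin n),
      MemLp G 2 volume ∧ IsWeakGradient u G

open scoped Classical in
/-- The weak gradient `∇u`, which is unique up to a null set (zero if there is none). -/
def weakGradient {n : ℕ} (u : EuclideanSpace ℝ (Fin n) → ℝ) :
    EuclideanSpace ℝ (Fin n) → EuclideanSpace ℝ (Fin n) :=
  if h : ∃ G, IsWeakGradient u G then h.choose else 0

/-- `u ∈ 𝕏(Ω)`: `u ∈ H¹(ℝⁿ)` and `u = 0` a.e. on `ℝⁿ \ Ω`. -/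
def MemX {n : ℕ} (Ω : Set (EuclideanSpace ℝ (Fin n))) (u : EuclideanSpace ℝ (Fin n) → ℝ) : Prop :=
  MemH1 u ∧ ∀ᵐ x ∂(volume.restrict Ωᶜ), u x = 0

/-- The bilinear form
`∫_Ω ⟨∇u, ∇v⟩ dx + ∬_{ℝ²ⁿ} (u(x) - u(y)) (v(x) - v(y)) / |x - y|^(n + 2s) dx dy`. -/
def bilinForm {n : ℕ} (s : ℝ) (Ω : Set (EuclideanSpace ℝ (Fin n)))
    (u v : EuclideanSpace ℝ (Fin n) → ℝ) : ℝ :=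
  (∫ x in Ω, inner ℝ (weakGradient u x) (weakGradient v x)) +
    ∫ p : EuclideanSpace ℝ (Fin n) × EuclideanSpace ℝ (Fin n),
      (u p.1 - u p.2) * (v p.1 - v p.2) / ‖p.1 - p.2‖ ^ ((n : ℝ) + 2 * s)

/-- The quadratic form associated with `bilinForm`. -/
def quadForm {n : ℕ} (s : ℝ) (Ω : Set (EuclideanSpace ℝ (Fin n)))
    (u : EuclideanSpace ℝ (Fin n) → ℝ) : ℝ :=
  bilinForm s Ω u u

/-- The principal Dirichlet eigenvalue of `-Δ + (-Δ)^s` in `Ω`: the infimum of the Rayleigh quotient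
over the nonzero elements of `𝕏(Ω)`. -/
def principalEigenvalue {n : ℕ} (s : ℝ) (Ω : Set (EuclideanSpace ℝ (Fin n))) : ℝ :=
  sInf {r : ℝ | ∃ u : EuclideanSpace ℝ (Fin n) → ℝ, MemX Ω u ∧ ¬ (u =ᵐ[volume] 0) ∧
    r = quadForm s Ω u / ∫ x in Ω, u x ^ 2}

/-- `u` is (a representative of) the principal eigenfunction of `-Δ + (-Δ)^s` in `Ω`: the nonnegative
element of `𝕏(Ω)` with unit `L²(Ω)` norm that attains the principal eigenvalue. -/
structure IsPrincipalEigenfunction {n : ℕ} (s : ℝ) (Ω : Set (EuclideanSpace ℝ (Fin n)))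
    (u : EuclideanSpace ℝ (Fin n) → ℝ) : Prop where
  memX : MemX Ω u
  norm_eq_one : eLpNorm u 2 (volume.restrict Ω) = 1
  quadForm_eq : principalEigenvalue s Ω = quadForm s Ω u
  nonneg : ∀ᵐ x ∂(volume.restrict Ω), 0 ≤ u x

end MixedOperator

end

noncomputable section

namespace MixedOperator

open Filter Topology Set

/-! Compare `u` with its truncation `v = min u M`, and put `w = u - v`. Since `v` lies in `𝕏(Ω)`,
the energy of `v` is at least `λ ∫ v²`, with equality when `v` is replaced by `u`. Truncation splits
increments: those of `v` and `w` have the same sign, so their squares add up to at most the squared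
increment of `u`. Hence the nonlocal energy of `v` does not exceed that of `u`, and subtraction
gives `∫ |∇w|² ≤ λ ∫ (u² - v²)`. No Euler–Lagrange equation is needed.

De Giorgi's method then applies. On `{u > M}` one has `u² - M² ≤ 2 w² + M²`, and Faber–Krahn bounds
`∫ w²` by `|{u > M}|^(2/n) ∫ |∇w|²` up to a constant. For large `M` the `w²` term is absorbed.
Chebyshev's inequality between two levels gives a superlinear recursion for `M ↦ ∫ ((u - M)⁺)²`,
which forces this quantity to vanish at a finite level.

The Sobolev theory rests on translations: `‖u(· + h) - u‖₂ ≤ ‖⟨∇u, h⟩‖₂`, and weak limits of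
difference quotients are weak gradients. These give the energy splitting, the finiteness of the
fractional energy and the Faber–Krahn inequality. The `C¹` boundary makes `∂Ω` null, so that `∫_Ω
|∇u|²` is the integral over the whole space. -/

variable {n : ℕ}

/-! ### Weak limits in Hilbert space -/

/-- A bounded sequence in a Hilbert space has a weak cluster point, and the weak limit of every
convergent pairing is attained at this point. -/
theorem exists_weak_limit {H : Type*} [NormedAddCommGroup H] [InnerProductSpace ℝ H]
    [CompleteSpace H] (z : ℕ → H) (C : ℝ) (hz : ∀ k, ‖z k‖ ≤ C) :
    ∃ y : H, ‖y‖ ≤ C ∧ ∀ (φ : H) (a : ℝ),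
      Tendsto (fun k => inner ℝ (z k) φ) atTop (𝓝 a) → inner ℝ y φ = a := by
  let T : ℕ → WeakDual ℝ H := fun k => (StrongDual.toWeakDual (InnerProductSpace.toDual ℝ H (z k)))
  -- Banach–Alaoglu along a free ultrafilter: neither separability nor a subsequence is needed.
  obtain ⟨ℓ, hℓ, hlim⟩ := (WeakDual.isCompact_closedBall (𝕜 := ℝ) (E := H) 0 C).ultrafilter_le_nhds
    ((hyperfilter ℕ).map T) (by
      rw [le_principal_iff]
      refine Filter.mem_map.2 (Filter.univ_mem' fun k => ?_)
      simp only [T, mem_preimage, mem_closedBall_zero_iff]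
      simpa using hz k)
  refine ⟨(InnerProductSpace.toDual ℝ H).symm (WeakDual.toStrongDual ℓ), ?_, fun φ a ha => ?_⟩
  · simpa using hℓ
  · have h1 : Tendsto (fun k => T k φ) (hyperfilter ℕ) (𝓝 (ℓ φ)) := by
      have := (WeakDual.eval_continuous (𝕜 := ℝ) (E := H) φ).tendsto ℓ
      exact this.comp hlim
    have h2 : Tendsto (fun k => T k φ) (hyperfilter ℕ) (𝓝 a) :=
      ha.mono_left Nat.hyperfilter_le_atTop
    rw [InnerProductSpace.toDual_symm_apply]
    exact tendsto_nhds_unique h1 h2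

/-- The pair version of `exists_weak_limit`, which keeps the sum of the squared norms bounded. -/
theorem exists_weak_limit_pair {H : Type*} [NormedAddCommGroup H] [InnerProductSpace ℝ H]
    [CompleteSpace H] (v w : ℕ → H) (C : ℝ) (hz : ∀ k, ‖v k‖ ^ 2 + ‖w k‖ ^ 2 ≤ C) :
    ∃ y z : H, ‖y‖ ^ 2 + ‖z‖ ^ 2 ≤ C ∧
      (∀ (φ : H) (a : ℝ), Tendsto (fun k => inner ℝ (v k) φ) atTop (𝓝 a) → inner ℝ y φ = a) ∧
      (∀ (φ : H) (a : ℝ), Tendsto (fun k => inner ℝ (w k) φ) atTop (𝓝 a) → inner ℝ z φ = a) := by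
  -- In the `L²` product the squared norm is the sum of the squares, so one weak limit keeps the
  -- joint bound.
  obtain ⟨p, hp, hlim⟩ := exists_weak_limit (fun k => WithLp.toLp 2 (v k, w k)) (√C) fun k => by
    apply Real.le_sqrt_of_sq_le
    rw [WithLp.prod_norm_sq_eq_of_L2]
    exact hz k
  refine ⟨p.fst, p.snd, ?_, fun φ a h => ?_, fun φ a h => ?_⟩
  · rw [← WithLp.prod_norm_sq_eq_of_L2]
    have hC : 0 ≤ C := le_trans (by positivity) (hz 0)
    exact (Real.le_sqrt (norm_nonneg _) hC).1 hp
  · simpa [WithLp.prod_inner_apply] using hlim (WithLp.toLp 2 (φ, 0)) a (by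
      simpa [WithLp.prod_inner_apply] using h)
  · simpa [WithLp.prod_inner_apply] using hlim (WithLp.toLp 2 (0, φ)) a (by
      simpa [WithLp.prod_inner_apply] using h)

/-! ### De Giorgi iteration -/

/-- De Giorgi's iteration lemma along levels. -/
theorem exists_level_eq_zero {a : ℝ → ℝ} {C δ M₀ : ℝ} (ha : AntitoneOn a (Ici M₀))
    (h0 : ∀ M, 0 ≤ a M) (hC : 0 < C) (hδ : 0 < δ) (hM₀ : 0 < M₀)
    (h : ∀ M M', M₀ ≤ M → M < M' → a M' ≤ C * M' ^ 2 * (a M / (M' - M) ^ 2) ^ (1 + δ)) :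
    ∃ K, M₀ ≤ K ∧ a K = 0 := by
  -- The decay rate solves `(4θ)^(1+δ) = θ`: it compensates the factor `4^j` lost to the shrinking
  -- gaps.
  set θ : ℝ := (4 : ℝ) ^ (-((1 + δ) / δ)) with hθ
  have hθ0 : 0 < θ := by positivity
  have hθ1 : θ < 1 := by
    apply Real.rpow_lt_one_of_one_lt_of_neg (by norm_num)
    have : 0 < (1 + δ) / δ := by positivity
    linarith
  have h4θ : (4 * θ) ^ (1 + δ) = θ := by
    have : (4 : ℝ) * θ = 4 ^ (1 - (1 + δ) / δ) := by
      rw [hθ, sub_eq_add_neg, Real.rpow_add (by norm_num), Real.rpow_one]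
    rw [this, hθ, ← Real.rpow_mul (by norm_num)]
    congr 1
    field_simp
    ring
  -- A small `b` closes the induction, because `b^(1+δ)` is of higher order than `b`.
  obtain ⟨b, hb0, hb⟩ : ∃ b : ℝ, 0 < b ∧ 4 * C * (4 * b) ^ (1 + δ) ≤ b * θ := by
    have hlim : Tendsto (fun b : ℝ => 4 * C * 4 ^ (1 + δ) * b ^ δ) (𝓝[>] 0) (𝓝 0) := by
      have : Tendsto (fun b : ℝ => 4 * C * 4 ^ (1 + δ) * b ^ δ) (𝓝 0)
          (𝓝 (4 * C * 4 ^ (1 + δ) * 0 ^ δ)) :=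
        ((Real.continuousAt_rpow_const 0 δ (Or.inr hδ.le)).tendsto).const_mul _
      rw [Real.zero_rpow hδ.ne', mul_zero] at this
      exact this.mono_left nhdsWithin_le_nhds
    obtain ⟨b, hb, hb0⟩ := ((hlim.eventually_lt_const hθ0).and self_mem_nhdsWithin).exists
    have hb0 : 0 < b := hb0
    refine ⟨b, hb0, ?_⟩
    rw [Real.mul_rpow (by norm_num) hb0.le, Real.rpow_add hb0, Real.rpow_one]
    nlinarith
  obtain ⟨K, hKM, hKB⟩ : ∃ K : ℝ, M₀ ≤ K ∧ a M₀ / b ≤ K ^ 2 := by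
    refine ⟨max (max M₀ 1) (a M₀ / b), (le_max_left _ _).trans (le_max_left _ _), ?_⟩
    have h1 : 1 ≤ max (max M₀ 1) (a M₀ / b) := (le_max_right _ _).trans (le_max_left _ _)
    have h2 : a M₀ / b ≤ max (max M₀ 1) (a M₀ / b) := le_max_right _ _
    nlinarith
  have hK0 : 0 < K := hM₀.trans_le hKM
  -- The levels rise from `K` to `2K`. The factors `K²` from `M'²` and from the gaps cancel, so `K`
  -- can be taken large after `b` is fixed.
  set k : ℕ → ℝ := fun j => K * (2 - (1 / 2) ^ j) with hk
  have hkK : ∀ j, K ≤ k j := fun j => by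
    have : (1 / 2 : ℝ) ^ j ≤ 1 := pow_le_one₀ (by norm_num) (by norm_num)
    simp only [hk]
    nlinarith
  have hk2 : ∀ j, k j ≤ 2 * K := fun j => by
    have : (0 : ℝ) < (1 / 2 : ℝ) ^ j := by positivity
    simp only [hk]
    nlinarith
  have hdiff : ∀ j, k (j + 1) - k j = K * (1 / 2) ^ (j + 1) := fun j => by
    simp only [hk, pow_succ]
    ring
  have key : ∀ j, a (k j) ≤ K ^ 2 * (b * θ ^ j) := by
    intro j
    induction j with
    | zero =>
      have := ha (mem_Ici.2 le_rfl) (hKM.trans (hkK 0)) (hKM.trans (hkK 0))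
      rw [div_le_iff₀ hb0] at hKB
      simpa using this.trans hKB
    | succ j ih =>
      have hd : 0 < K * (1 / 2 : ℝ) ^ (j + 1) := by positivity
      have h1 := h (k j) (k (j + 1)) (hKM.trans (hkK j)) (by linarith [hdiff j])
      rw [hdiff] at h1
      have h2 : a (k j) / (K * (1 / 2) ^ (j + 1)) ^ 2 ≤ 4 * b * (4 * θ) ^ j := by
        rw [div_le_iff₀ (by positivity)]
        refine ih.trans (le_of_eq ?_)
        have : ((1 / 2 : ℝ) ^ (j + 1)) ^ 2 * (4 * 4 ^ j) = 1 := by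
          rw [← pow_succ', ← pow_mul, mul_comm (j + 1), pow_mul, ← mul_pow]
          norm_num
        rw [mul_pow, mul_pow]
        linear_combination (-K ^ 2 * b * θ ^ j) * this
      have h3 : (a (k j) / (K * (1 / 2) ^ (j + 1)) ^ 2) ^ (1 + δ)
          ≤ (4 * b) ^ (1 + δ) * θ ^ j := by
        refine (Real.rpow_le_rpow (div_nonneg (h0 _) (by positivity)) h2 (by linarith)).trans ?_
        rw [Real.mul_rpow (by positivity) (by positivity), ← Real.rpow_natCast (4 * θ) j,
          ← Real.rpow_mul (by positivity), mul_comm (j : ℝ), Real.rpow_mul (by positivity), h4θ,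
          Real.rpow_natCast]
      calc a (k (j + 1)) ≤ _ := h1
        _ ≤ C * (2 * K) ^ 2 * ((4 * b) ^ (1 + δ) * θ ^ j) := by
          have := hk2 (j + 1)
          have h5 : 0 ≤ k (j + 1) := hK0.le.trans (hkK _)
          have h6 : 0 ≤ a (k j) / (K * (1 / 2) ^ (j + 1)) ^ 2 := div_nonneg (h0 _) (by positivity)
          gcongr
        _ = K ^ 2 * θ ^ j * (4 * C * (4 * b) ^ (1 + δ)) := by ring
        _ ≤ K ^ 2 * θ ^ j * (b * θ) := by gcongr
        _ = K ^ 2 * (b * θ ^ (j + 1)) := by ring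
  refine ⟨2 * K, by linarith, le_antisymm ?_ (h0 _)⟩
  have hlim : Tendsto (fun j => K ^ 2 * (b * θ ^ j)) atTop (𝓝 (K ^ 2 * (b * 0))) :=
    ((tendsto_pow_atTop_nhds_zero_of_lt_one hθ0.le hθ1).const_mul b).const_mul _
  rw [mul_zero, mul_zero] at hlim
  exact ge_of_tendsto' hlim fun j => (ha (hKM.trans (hkK j))
    (mem_Ici.2 (by linarith)) (hk2 j)).trans (key j)

/-! ### Pairings and duality in `L²` -/

section LTwo

variable {α F : Type*} {m : MeasurableSpace α} {μ : Measure α} [NormedAddCommGroup F]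
  [InnerProductSpace ℝ F]

theorem inner_toLp_toLp {f g : α → F} (hf : MemLp f 2 μ) (hg : MemLp g 2 μ) :
    inner ℝ (hf.toLp f) (hg.toLp g) = ∫ x, inner ℝ (f x) (g x) ∂μ := by
  rw [L2.inner_def]
  refine integral_congr_ae ?_
  filter_upwards [hf.coeFn_toLp, hg.coeFn_toLp] with x h1 h2
  rw [h1, h2]

theorem norm_toLp_sq {f : α → F} (hf : MemLp f 2 μ) :
    ‖hf.toLp f‖ ^ 2 = ∫ x, ‖f x‖ ^ 2 ∂μ := by
  rw [← real_inner_self_eq_norm_sq, inner_toLp_toLp hf hf]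
  simp_rw [real_inner_self_eq_norm_sq]

theorem abs_integral_mul_le_sqrt {f g : α → ℝ} (hf : MemLp f 2 μ) (hg : MemLp g 2 μ) :
    |∫ x, f x * g x ∂μ| ≤ √(∫ x, f x ^ 2 ∂μ) * √(∫ x, g x ^ 2 ∂μ) := by
  have h := abs_real_inner_le_norm (hf.toLp f) (hg.toLp g)
  have hsq : ∀ {k : α → ℝ} (hk : MemLp k 2 μ), ‖hk.toLp k‖ = √(∫ x, k x ^ 2 ∂μ) := fun hk => by
    have := norm_toLp_sq hk
    simp only [Real.norm_eq_abs, sq_abs] at this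
    rw [← this, Real.sqrt_sq (norm_nonneg _)]
  rw [inner_toLp_toLp, hsq, hsq] at h
  simpa [mul_comm] using h

end LTwo

/-- Duality: the `L²` norm is determined by the pairing with test functions. -/
theorem integral_sq_le_of_forall_test {g : EuclideanSpace ℝ (Fin n) → ℝ} (hg : MemLp g 2 volume)
    {C : ℝ} (h : ∀ φ : EuclideanSpace ℝ (Fin n) → ℝ, ContDiff ℝ ∞ φ → HasCompactSupport φ →
      ∫ x, g x * φ x ≤ √C * √(∫ x, φ x ^ 2)) (hC : 0 ≤ C) :
    ∫ x, g x ^ 2 ≤ C := by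
  have hclosed : IsClosed {f : Lp ℝ 2 (volume : Measure (EuclideanSpace ℝ (Fin n))) |
      inner ℝ (hg.toLp g) f ≤ √C * ‖f‖} :=
    isClosed_le (by fun_prop) (by fun_prop)
  have hall : inner ℝ (hg.toLp g) (hg.toLp g) ≤ √C * ‖hg.toLp g‖ := by
    have hdense := Lp.dense_hasCompactSupport_contDiff (F := ℝ) (p := 2)
      (μ := (volume : Measure (EuclideanSpace ℝ (Fin n)))) (by norm_num)
    refine hclosed.closure_subset_iff.2 ?_ (hdense (hg.toLp g))
    rintro f ⟨φ, hfφ, hφ, hφ'⟩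
    have hmem : MemLp φ 2 (volume : Measure (EuclideanSpace ℝ (Fin n))) :=
      hφ'.continuous.memLp_of_hasCompactSupport hφ
    have hf : f = hmem.toLp φ := Lp.ext (hfφ.trans hmem.coeFn_toLp.symm)
    have hn : ‖hmem.toLp φ‖ = √(∫ x, φ x ^ 2) := by
      have := norm_toLp_sq hmem
      simp only [Real.norm_eq_abs, sq_abs] at this
      rw [← this, Real.sqrt_sq (norm_nonneg _)]
    simp only [mem_ofPred_eq]
    rw [hf, inner_toLp_toLp, hn]
    simpa [mul_comm] using h φ hφ' hφ
  have hn := norm_toLp_sq hg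
  simp only [Real.norm_eq_abs, sq_abs] at hn
  rw [real_inner_self_eq_norm_sq] at hall
  rw [← hn]
  rcases (norm_nonneg (hg.toLp g)).eq_or_lt with h0 | h0
  · rw [← h0]
    simpa using hC
  · have : ‖hg.toLp g‖ ≤ √C := by nlinarith
    exact (Real.le_sqrt (norm_nonneg _) hC).1 this

/-! ### Translations, difference quotients and weak gradients -/

/-- The integral is the convolution of `u` with the reflected test function, evaluated at `t • e`;
the derivative falls on the smooth factor. -/
theorem hasDerivAt_integral_mul_translate {u φ : EuclideanSpace ℝ (Fin n) → ℝ}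
    (hu : LocallyIntegrable u volume) (hφ : ContDiff ℝ ∞ φ) (hc : HasCompactSupport φ)
    (e : EuclideanSpace ℝ (Fin n)) (t : ℝ) :
    HasDerivAt (fun t : ℝ => ∫ x, u x * φ (x - t • e))
      (-∫ x, u x * fderiv ℝ φ (x - t • e) e) t := by
  set g : EuclideanSpace ℝ (Fin n) → ℝ := fun y => φ (-y) with hgdef
  have hφ1 : ContDiff ℝ 1 φ := hφ.of_le (by norm_cast)
  have hg : ContDiff ℝ 1 g := hφ1.comp contDiff_neg
  have hgc : HasCompactSupport g := hc.comp_homeomorph (Homeomorph.neg _)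
  have h1 := hgc.hasFDerivAt_convolution_right (ContinuousLinearMap.mul ℝ ℝ) hu hg (t • e)
  have h2 : HasDerivAt (fun t : ℝ => t • e) e t := by
    simpa using (hasDerivAt_id t).smul_const e
  have h3 := h1.comp_hasDerivAt t h2
  rw [convolution_precompR_apply _ hu (hgc.fderiv ℝ) (hg.continuous_fderiv one_ne_zero)] at h3
  have hfd : ∀ y, fderiv ℝ g y e = -fderiv ℝ φ (-y) e := fun y => by
    have h4 := ((hφ1.differentiable one_ne_zero (-y)).hasFDerivAt).comp y (hasFDerivAt_id y).neg
    have h5 : fderiv ℝ g y = _ := h4.fderiv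
    rw [h5]
    simp
  have hval : convolution u (fun a => fderiv ℝ g a e) (ContinuousLinearMap.mul ℝ ℝ) volume (t • e)
      = -∫ x, u x * fderiv ℝ φ (x - t • e) e := by
    rw [convolution_def, ← integral_neg]
    simp [hfd]
  rw [hval] at h3
  refine h3.congr_of_eventuallyEq (.of_forall fun t => ?_)
  simp [convolution_def, hgdef]

/-- Translations of an `H¹` function are controlled by the weak gradient. -/
theorem IsWeakGradient.integral_translate_sub_sq_le {u : EuclideanSpace ℝ (Fin n) → ℝ}
    {G : EuclideanSpace ℝ (Fin n) → EuclideanSpace ℝ (Fin n)} (hG : IsWeakGradient u G)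
    (hu2 : MemLp u 2 volume) (hG2 : MemLp G 2 volume) (h : EuclideanSpace ℝ (Fin n)) :
    ∫ x, (u (x + h) - u x) ^ 2 ≤ ∫ x, inner ℝ (G x) h ^ 2 := by
  have hut : MemLp (fun x => u (x + h)) 2 volume :=
    hu2.comp_measurePreserving (measurePreserving_add_right volume h)
  have hGh : MemLp (fun x => inner ℝ (G x) h) 2 volume := hG2.inner_const h
  refine integral_sq_le_of_forall_test (hut.sub hu2) (fun φ hφ hc => ?_)
    (integral_nonneg fun x => sq_nonneg _)
  have hφ2 : MemLp φ 2 volume := hφ.continuous.memLp_of_hasCompactSupport hc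
  have hφt : ∀ t : ℝ, MemLp (fun x => φ (x - t • h)) 2 volume := fun t =>
    hφ2.comp_measurePreserving (measurePreserving_sub_right volume _)
  have hderiv := hasDerivAt_integral_mul_translate hG.1 hφ hc h
  -- The weak gradient identity for the translated test function turns the derivative into a pairing
  -- with `⟨G, h⟩`. Cauchy–Schwarz then gives a bound uniform in `t`, and the mean value inequality
  -- on `[0, 1]` concludes.
  have hbound : ∀ t : ℝ, ‖-∫ x, u x * fderiv ℝ φ (x - t • h) h‖
      ≤ √(∫ x, inner ℝ (G x) h ^ 2) * √(∫ x, φ x ^ 2) := fun t => by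
    have hs := hG.2.2 (fun x => φ (x - t • h)) (hφ.comp (contDiff_id.sub contDiff_const))
      (hc.comp_homeomorph (Homeomorph.subRight (t • h))) h
    simp_rw [fderiv_comp_sub (𝕜 := ℝ) (f := φ)] at hs
    rw [hs, neg_neg]
    refine (abs_integral_mul_le_sqrt hGh (hφt t)).trans (le_of_eq ?_)
    rw [integral_sub_right_eq_self (fun x => φ x ^ 2) (t • h)]
  have hmv := (convex_univ (𝕜 := ℝ) (E := ℝ)).norm_image_sub_le_of_norm_hasDerivWithin_le
    (fun t _ => (hderiv t).hasDerivWithinAt) (fun t _ => hbound t) (mem_univ 0) (mem_univ 1)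
  have hsub : ∫ x, (u (x + h) - u x) * φ x = (∫ x, u x * φ (x - (1 : ℝ) • h))
      - ∫ x, u x * φ (x - (0 : ℝ) • h) := by
    rw [← integral_add_right_eq_self (fun x => u x * φ (x - (1 : ℝ) • h)) h]
    simp only [one_smul, zero_smul, sub_zero, add_sub_cancel_right]
    simp_rw [sub_mul]
    exact integral_sub (hut.integrable_mul hφ2) (hu2.integrable_mul hφ2)
  change ∫ x, (u (x + h) - u x) * φ x ≤ _
  rw [hsub]
  refine (le_abs_self _).trans ?_
  simpa using hmv

/-- The vector of difference quotients of `u` in the coordinate directions, with step `t`. -/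
def diffQuot (u : EuclideanSpace ℝ (Fin n) → ℝ) (t : ℝ) (x : EuclideanSpace ℝ (Fin n)) :
    EuclideanSpace ℝ (Fin n) :=
  WithLp.toLp 2 fun i => t⁻¹ * (u (x + t • EuclideanSpace.single i 1) - u x)

theorem memLp_translate {u : EuclideanSpace ℝ (Fin n) → ℝ} (hu : MemLp u 2 volume)
    (h : EuclideanSpace ℝ (Fin n)) : MemLp (fun x => u (x + h)) 2 volume :=
  hu.comp_measurePreserving (measurePreserving_add_right volume h)

theorem memLp_diffQuot {u : EuclideanSpace ℝ (Fin n) → ℝ} (hu : MemLp u 2 volume) (t : ℝ) :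
    MemLp (diffQuot u t) 2 volume :=
  MemLp.of_eval_piLp fun _ => ((memLp_translate hu _).sub hu).const_mul t⁻¹

theorem norm_diffQuot_sq (u : EuclideanSpace ℝ (Fin n) → ℝ) (t : ℝ)
    (x : EuclideanSpace ℝ (Fin n)) :
    ‖diffQuot u t x‖ ^ 2
      = ∑ i, (t⁻¹ * (u (x + t • EuclideanSpace.single i 1) - u x)) ^ 2 := by
  rw [EuclideanSpace.norm_sq_eq]
  simp only [diffQuot, Real.norm_eq_abs, sq_abs]

theorem IsWeakGradient.integral_diffQuot_sq_le {u : EuclideanSpace ℝ (Fin n) → ℝ}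
    {G : EuclideanSpace ℝ (Fin n) → EuclideanSpace ℝ (Fin n)} (hG : IsWeakGradient u G)
    (hu2 : MemLp u 2 volume) (hG2 : MemLp G 2 volume) {t : ℝ} (ht : t ≠ 0) :
    ∫ x, ‖diffQuot u t x‖ ^ 2 ≤ ∫ x, ‖G x‖ ^ 2 := by
  simp_rw [norm_diffQuot_sq, EuclideanSpace.norm_sq_eq, Real.norm_eq_abs, sq_abs]
  have h1 : ∀ i, MemLp (fun x => t⁻¹ * (u (x + t • EuclideanSpace.single i 1) - u x)) 2 volume :=
    fun i => ((memLp_translate hu2 _).sub hu2).const_mul t⁻¹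
  rw [integral_finsetSum _ fun i _ => (h1 i).integrable_sq,
    integral_finsetSum _ fun i _ => (hG2.eval_piLp i).integrable_sq]
  refine Finset.sum_le_sum fun i _ => ?_
  have h2 := hG.integral_translate_sub_sq_le hu2 hG2 (t • EuclideanSpace.single i 1)
  simp_rw [real_inner_smul_right, EuclideanSpace.inner_single_right, mul_pow] at h2
  simp_rw [mul_pow]
  rw [integral_const_mul] at h2 ⊢
  rw [inv_pow, inv_mul_le_iff₀ (by positivity)]
  simpa using h2

/-- Discrete integration by parts: a change of variables moves the shift onto `φ`, leaving the slope
at `0` of the translated pairing. -/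
theorem tendsto_integral_inner_diffQuot {f φ : EuclideanSpace ℝ (Fin n) → ℝ}
    (hf : MemLp f 2 volume) (hφ : ContDiff ℝ ∞ φ) (hc : HasCompactSupport φ)
    (e : EuclideanSpace ℝ (Fin n)) :
    Tendsto (fun t : ℝ => ∫ x, inner ℝ (diffQuot f t x) (φ x • e)) (𝓝[≠] 0)
      (𝓝 (-∫ x, f x * fderiv ℝ φ x e)) := by
  have hfl : LocallyIntegrable f volume := hf.locallyIntegrable (by norm_num)
  have hφ2 : MemLp φ 2 volume := hφ.continuous.memLp_of_hasCompactSupport hc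
  have hd2 : ∀ e : EuclideanSpace ℝ (Fin n), MemLp (fun x => fderiv ℝ φ x e) 2 volume := fun e =>
    Continuous.memLp_of_hasCompactSupport
      ((hφ.continuous_fderiv (by simp)).clm_apply continuous_const) (hc.fderiv_apply ℝ e)
  have hsum : -∫ x, f x * fderiv ℝ φ x e
      = ∑ i, e i * -∫ x, f x * fderiv ℝ φ x (EuclideanSpace.single i 1) := by
    have : ∀ x, f x * fderiv ℝ φ x e
        = ∑ i, e i * (f x * fderiv ℝ φ x (EuclideanSpace.single i 1)) := fun x => by
      have he : e = ∑ i, e i • EuclideanSpace.single i (1 : ℝ) := by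
        ext j
        simp [Pi.single_apply]
      conv_lhs => rw [he, map_sum, Finset.mul_sum]
      refine Finset.sum_congr rfl fun i _ => ?_
      rw [map_smul, smul_eq_mul]
      ring
    have hi : ∀ i, Integrable (fun x => f x * fderiv ℝ φ x (EuclideanSpace.single i 1)) volume :=
      fun i => hf.integrable_mul (hd2 _)
    simp_rw [this]
    rw [integral_finsetSum _ fun i _ => (hi i).const_mul _,
      ← Finset.sum_neg_distrib]
    refine Finset.sum_congr rfl fun i _ => ?_
    rw [integral_const_mul, mul_neg]
  have hq : ∀ t : ℝ, ∫ x, inner ℝ (diffQuot f t x) (φ x • e)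
      = ∑ i, e i * (t⁻¹ • ((∫ x, f x * φ (x - (0 + t) • EuclideanSpace.single i 1))
        - ∫ x, f x * φ (x - (0 : ℝ) • EuclideanSpace.single i 1))) := fun t => by
    have : ∀ x, inner ℝ (diffQuot f t x) (φ x • e) = ∑ i, e i *
        (t⁻¹ * (f (x + t • EuclideanSpace.single i 1) * φ x - f x * φ x)) := fun x => by
      simp only [PiLp.inner_apply, diffQuot]
      refine Finset.sum_congr rfl fun i _ => ?_
      simp
      ring
    simp_rw [this]
    have hi : ∀ i, Integrable (fun x => f (x + t • EuclideanSpace.single i 1) * φ x) volume :=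
      fun i => (memLp_translate hf _).integrable_mul hφ2
    have hi0 : Integrable (fun x => f x * φ x) volume := hf.integrable_mul hφ2
    have hi1 : ∀ i, Integrable
        (fun x => f (x + t • EuclideanSpace.single i 1) * φ x - f x * φ x) volume :=
      fun i => (hi i).sub hi0
    rw [integral_finsetSum _ fun i _ => ((hi1 i).const_mul _).const_mul _]
    refine Finset.sum_congr rfl fun i _ => ?_
    rw [integral_const_mul, integral_const_mul, integral_sub (hi i) hi0, smul_eq_mul,
      ← integral_add_right_eq_self (fun x => f x * φ (x - (0 + t) • EuclideanSpace.single i 1))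
        (t • EuclideanSpace.single i 1)]
    simp
  simp_rw [hq]
  rw [hsum]
  refine tendsto_finsetSum _ fun i _ => Tendsto.const_mul _ ?_
  simpa using (hasDerivAt_integral_mul_translate hfl hφ hc
    (EuclideanSpace.single i 1) 0).tendsto_slope_zero

/-- Against the fields `φ • e` the difference quotients converge to the distributional derivative,
so the weak limit must represent it. -/
theorem isWeakGradient_of_inner_eq {f : EuclideanSpace ℝ (Fin n) → ℝ} (hf : MemLp f 2 volume)
    (y : Lp (EuclideanSpace ℝ (Fin n)) 2 (volume : Measure (EuclideanSpace ℝ (Fin n))))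
    (h : ∀ (ψ : Lp (EuclideanSpace ℝ (Fin n)) 2 (volume : Measure (EuclideanSpace ℝ (Fin n))))
      (a : ℝ), Tendsto (fun k : ℕ => inner ℝ
        ((memLp_diffQuot hf (1 / ((k : ℝ) + 1))).toLp (diffQuot f (1 / ((k : ℝ) + 1)))) ψ)
        atTop (𝓝 a) → inner ℝ y ψ = a) :
    IsWeakGradient f y := by
  refine ⟨hf.locallyIntegrable (by norm_num), (Lp.memLp y).locallyIntegrable (by norm_num),
    fun φ hφ hc e => ?_⟩
  have hφ2 : MemLp (fun x => φ x • e) 2 volume :=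
    Continuous.memLp_of_hasCompactSupport (hφ.continuous.smul continuous_const) hc.smul_right
  have hlim := h (hφ2.toLp _) (-∫ x, f x * fderiv ℝ φ x e) (by
    simp_rw [inner_toLp_toLp]
    refine (tendsto_integral_inner_diffQuot hf hφ hc e).comp ?_
    refine tendsto_nhdsWithin_iff.2 ⟨tendsto_one_div_add_atTop_nhds_zero_nat,
      .of_forall fun k => ?_⟩
    simp only [mem_compl_iff, mem_singleton_iff]
    positivity)
  rw [← neg_eq_iff_eq_neg] at hlim
  rw [← hlim, L2.inner_def]
  congr 1
  refine integral_congr_ae ?_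
  filter_upwards [hφ2.coeFn_toLp] with x hx
  rw [hx, real_inner_smul_right, mul_comm]

/-- If the increments of `v` and `w` are jointly dominated by those of an `H¹` function `u`, then `v`
and `w` are in `H¹` and their Dirichlet energies are jointly dominated by that of `u`. -/
theorem exists_isWeakGradient_pair {u v w : EuclideanSpace ℝ (Fin n) → ℝ}
    {G : EuclideanSpace ℝ (Fin n) → EuclideanSpace ℝ (Fin n)} (hG : IsWeakGradient u G)
    (hu2 : MemLp u 2 volume) (hG2 : MemLp G 2 volume) (hv : MemLp v 2 volume)
    (hw : MemLp w 2 volume)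
    (h : ∀ x y, (v x - v y) ^ 2 + (w x - w y) ^ 2 ≤ (u x - u y) ^ 2) :
    ∃ Gv Gw : EuclideanSpace ℝ (Fin n) → EuclideanSpace ℝ (Fin n),
      MemLp Gv 2 volume ∧ IsWeakGradient v Gv ∧ MemLp Gw 2 volume ∧ IsWeakGradient w Gw ∧
      (∫ x, ‖Gv x‖ ^ 2) + (∫ x, ‖Gw x‖ ^ 2) ≤ ∫ x, ‖G x‖ ^ 2 := by
  obtain ⟨y, z, hyz, hy, hz⟩ := exists_weak_limit_pair
    (fun k : ℕ => (memLp_diffQuot hv (1 / ((k : ℝ) + 1))).toLp _)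
    (fun k : ℕ => (memLp_diffQuot hw (1 / ((k : ℝ) + 1))).toLp _) (∫ x, ‖G x‖ ^ 2) (fun k => by
      have hmem : ∀ {f : EuclideanSpace ℝ (Fin n) → ℝ}, MemLp f 2 volume →
          Integrable (fun x => ‖diffQuot f (1 / ((k : ℝ) + 1)) x‖ ^ 2) volume := fun hf =>
        (memLp_two_iff_integrable_sq_norm (memLp_diffQuot hf _).1).1 (memLp_diffQuot hf _)
      rw [norm_toLp_sq, norm_toLp_sq, ← integral_add (hmem hv) (hmem hw)]
      refine (integral_mono ((hmem hv).add (hmem hw)) (hmem hu2) fun x => ?_).trans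
        (hG.integral_diffQuot_sq_le hu2 hG2 (t := 1 / ((k : ℝ) + 1)) (by positivity))
      simp only [Pi.add_apply, norm_diffQuot_sq]
      rw [← Finset.sum_add_distrib]
      refine Finset.sum_le_sum fun i _ => ?_
      rw [mul_pow, mul_pow, mul_pow, ← mul_add]
      exact mul_le_mul_of_nonneg_left (h _ _) (sq_nonneg _))
  have hn : ∀ f : Lp (EuclideanSpace ℝ (Fin n)) 2
      (volume : Measure (EuclideanSpace ℝ (Fin n))), ∫ x, ‖f x‖ ^ 2 = ‖f‖ ^ 2 := fun f => by
    rw [← norm_toLp_sq (Lp.memLp f), Lp.toLp_coeFn]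
  refine ⟨y, z, Lp.memLp y, isWeakGradient_of_inner_eq hv y hy, Lp.memLp z,
    isWeakGradient_of_inner_eq hw z hz, ?_⟩
  rw [hn, hn]
  exact hyz

/-! ### Truncation -/

/-- Both `min · M` and `· - min · M` are nondecreasing, so the two increments have the same sign and
the cross term in the square of their sum is nonnegative. -/
theorem truncation_increment_le (a b M : ℝ) :
    (min a M - min b M) ^ 2 + ((a - min a M) - (b - min b M)) ^ 2 ≤ (a - b) ^ 2 := by
  rcases le_total a M with h1 | h1 <;> rcases le_total b M with h2 | h2 <;>
    simp only [h1, h2, min_eq_left, min_eq_right] <;> nlinarith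

theorem memLp_min_const {u : EuclideanSpace ℝ (Fin n) → ℝ} (hu : MemLp u 2 volume) {M : ℝ}
    (hM : 0 ≤ M) : MemLp (fun x => min (u x) M) 2 volume := by
  refine hu.of_le (hu.1.inf aestronglyMeasurable_const) (.of_forall fun x => ?_)
  rw [Real.norm_eq_abs, Real.norm_eq_abs]
  rcases le_total (u x) M with h | h
  · simp [h]
  · rw [min_eq_right h, abs_of_nonneg hM]
    exact h.trans (le_abs_self _)

/-! ### Null boundary, uniqueness and locality of the weak gradient -/

/-- The frontier of an open set with `C¹` boundary is a null set. -/
theorem HasC1Boundary.volume_frontier {Ω : Set (EuclideanSpace ℝ (Fin n))}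
    (hΩ : HasC1Boundary Ω) (hΩo : IsOpen Ω) : volume (frontier Ω) = 0 := by
  -- By Lebesgue's density theorem the frontier has density one at almost all of its points; it is
  -- shown that no frontier point has this property.
  have hdens := Besicovitch.ae_tendsto_measure_inter_div
    (volume : Measure (EuclideanSpace ℝ (Fin n))) (frontier Ω)
  rw [ae_restrict_iff' isClosed_frontier.measurableSet] at hdens
  refine measure_mono_null (fun p hp => ?_) (ae_iff.1 hdens)
  simp only [mem_ofPred_eq]
  intro himp
  have hlim := himp hp
  obtain ⟨U, ρ, hUo, hpU, hρ, hdρ, hΩU⟩ := hΩ p hp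
  have hρc : ContinuousOn ρ U := hρ.continuousOn
  have hzero : ∀ q ∈ frontier Ω, q ∈ U → ρ q = 0 := by
    intro q hq hqU
    refine le_antisymm ?_ ?_
    · by_contra! hpos
      have hev : ∀ᶠ x in 𝓝 q, 0 < ρ x :=
        (hρc.continuousAt (hUo.mem_nhds hqU)).eventually (lt_mem_nhds hpos)
      obtain ⟨x, ⟨hx1, hx2⟩, hx3⟩ :=
        ((mem_closure_iff_frequently.1 hq.1).and_eventually
          (hUo.mem_nhds hqU)).and_eventually hev |>.exists
      have : x ∈ {x ∈ U | ρ x < 0} := hΩU ▸ ⟨hx1, hx2⟩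
      exact absurd this.2 (not_lt.2 hx3.le)
    · by_contra! hneg
      have : q ∈ Ω ∩ U := hΩU ▸ ⟨hqU, hneg⟩
      rw [hΩo.frontier_eq] at hq
      exact hq.2 this.1
  obtain ⟨v, hv1, hv⟩ : ∃ v : EuclideanSpace ℝ (Fin n), ‖v‖ = 1 ∧ 0 < fderiv ℝ ρ p v := by
    obtain ⟨w, hw⟩ : ∃ w, fderiv ℝ ρ p w ≠ 0 := by
      by_contra! h
      exact hdρ (ContinuousLinearMap.ext h)
    have hw0 : w ≠ 0 := by
      rintro rfl
      simp at hw
    have hwn : 0 < ‖w‖ := norm_pos_iff.2 hw0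
    have hwu : ‖‖w‖⁻¹ • w‖ = 1 := by
      rw [norm_smul, norm_inv, norm_norm, inv_mul_cancel₀ hwn.ne']
    rcases hw.lt_or_gt with h | h
    · refine ⟨-(‖w‖⁻¹ • w), by rwa [norm_neg], ?_⟩
      rw [map_neg, map_smul, smul_eq_mul]
      have := mul_pos (inv_pos.2 hwn) (neg_pos.2 h)
      linarith
    · refine ⟨‖w‖⁻¹ • w, hwu, ?_⟩
      rw [map_smul, smul_eq_mul]
      exact mul_pos (inv_pos.2 hwn) h
  have : Nontrivial (EuclideanSpace ℝ (Fin n)) := ⟨v, 0, by rintro rfl; simp at hv⟩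
  set L := fderiv ℝ ρ p with hL
  set c := L v with hc
  -- The ball of radius `rη` around `p + (r/2) v` lies in the ball of radius `r` around `p`. On it
  -- `L (x - p)` is at least `3cr/8`, above the linearization error `cr/8`, so `ρ` has no zero
  -- there. It takes the fixed fraction `η^n` of the volume away from the frontier.
  obtain ⟨η, hη0, hη2, hηL⟩ : ∃ η : ℝ, 0 < η ∧ η ≤ 1 / 2 ∧ ‖L‖ * η ≤ c / 8 := by
    refine ⟨min (1 / 2) (c / 8 / (‖L‖ + 1)), by positivity, min_le_left _ _, ?_⟩
    calc ‖L‖ * min (1 / 2) (c / 8 / (‖L‖ + 1)) ≤ (‖L‖ + 1) * (c / 8 / (‖L‖ + 1)) := by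
          gcongr
          · linarith
          · exact min_le_right _ _
      _ = c / 8 := by field_simp
  have hdiff : HasFDerivAt ρ L p :=
    ((hρ.contDiffAt (hUo.mem_nhds hpU)).differentiableAt one_ne_zero).hasFDerivAt
  have hsmall := hdiff.isLittleO.def (show 0 < c / 8 by positivity)
  obtain ⟨r₀, hr₀, hball⟩ := Metric.eventually_nhds_iff.1 (hsmall.and (hUo.mem_nhds hpU))
  set κ : ℝ≥0∞ := ENNReal.ofReal (η ^ n) with hκ
  have hratio : ∀ᶠ r in 𝓝[>] (0 : ℝ), volume (frontier Ω ∩ Metric.closedBall p r)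
      / volume (Metric.closedBall p r) + κ ≤ 1 := by
    filter_upwards [Ioo_mem_nhdsGT hr₀] with r hr
    have hr0 : 0 < r := hr.1
    set q := p + (r / 2) • v with hq
    have hin : Metric.ball q (r * η) ⊆ Metric.closedBall p r := by
      intro x hx
      have h1 : dist x q < r * η := hx
      have h2 : dist q p = r / 2 := by
        rw [hq, dist_eq_norm, add_sub_cancel_left, norm_smul, hv1, mul_one, Real.norm_eq_abs,
          abs_of_pos (by positivity)]
      have h3 := dist_triangle x q p
      have h4 : dist x p ≤ r := by nlinarith
      exact h4
    have hout : Disjoint (frontier Ω ∩ Metric.closedBall p r) (Metric.ball q (r * η)) := by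
      rw [Set.disjoint_left]
      rintro x ⟨hxS, hxp⟩ hxq
      have hxp' : ‖x - p‖ ≤ r := by
        have : dist x p ≤ r := hxp
        rwa [dist_eq_norm] at this
      have hxq' : ‖x - q‖ ≤ r * η := by
        have : dist x q < r * η := hxq
        rw [dist_eq_norm] at this
        exact this.le
      obtain ⟨h1, hxU⟩ := hball (show dist x p < r₀ by
        rw [dist_eq_norm]
        exact hxp'.trans_lt hr.2)
      rw [hzero x hxS hxU, hzero p hp hpU] at h1
      have h2 : L (x - p) = r / 2 * c + L (x - q) := by
        have : x - p = (r / 2) • v + (x - q) := by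
          rw [hq]
          abel
        rw [this, map_add, map_smul, smul_eq_mul]
      have h3 : |L (x - q)| ≤ ‖L‖ * (r * η) :=
        (L.le_opNorm _).trans (mul_le_mul_of_nonneg_left hxq' (norm_nonneg _))
      have h4 : ‖L (x - p)‖ ≤ c / 8 * r := by
        rw [sub_self, zero_sub, norm_neg] at h1
        exact h1.trans (mul_le_mul_of_nonneg_left hxp' (by positivity))
      have h5 := (le_abs_self _).trans h4
      have h6 := (abs_le.1 h3).1
      have h7 : ‖L‖ * (r * η) ≤ r * (c / 8) := by nlinarith
      have h8 : 0 < r * c := by positivity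
      rw [h2] at h5
      linarith
    have hpos : volume (Metric.closedBall p r) ≠ 0 :=
      (Metric.measure_closedBall_pos _ _ hr0).ne'
    have hfin : volume (Metric.closedBall p r) ≠ ⊤ := measure_closedBall_lt_top.ne
    have hvol : volume (Metric.ball q (r * η)) = κ * volume (Metric.closedBall p r) := by
      rw [mul_comm r η, Measure.addHaar_ball_mul_of_pos _ _ hη0,
        Measure.addHaar_closedBall_eq_addHaar_ball, ← Measure.addHaar_ball_center volume p r,
        finrank_euclideanSpace_fin]
    have hsum : volume (frontier Ω ∩ Metric.closedBall p r)
        + κ * volume (Metric.closedBall p r) ≤ volume (Metric.closedBall p r) := by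
      rw [← hvol, ← measure_union hout measurableSet_ball]
      exact measure_mono (union_subset inter_subset_right hin)
    calc _ = (volume (frontier Ω ∩ Metric.closedBall p r) + κ * volume (Metric.closedBall p r))
          / volume (Metric.closedBall p r) := by
          rw [ENNReal.add_div, ENNReal.mul_div_cancel_right hpos hfin]
      _ ≤ _ := ENNReal.div_le_of_le_mul (by rwa [one_mul])
  have hle : 1 + κ ≤ 1 := le_of_tendsto (hlim.add_const κ) hratio
  have hκ0 : κ = 0 := by
    by_contra hne
    exact absurd hle (not_le.2 (ENNReal.lt_add_right ENNReal.one_ne_top hne))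
  rw [hκ, ENNReal.ofReal_eq_zero] at hκ0
  exact absurd hκ0 (not_le.2 (by positivity))

theorem IsWeakGradient.integral_smul_eq_zero_of_test {u : EuclideanSpace ℝ (Fin n) → ℝ}
    {G : EuclideanSpace ℝ (Fin n) → EuclideanSpace ℝ (Fin n)} (hG : IsWeakGradient u G)
    {φ : EuclideanSpace ℝ (Fin n) → ℝ} (hφ : ContDiff ℝ ∞ φ) (hc : HasCompactSupport φ)
    (h : ∀ e, ∫ x, u x * fderiv ℝ φ x e = 0) : ∫ x, φ x • G x = 0 := by
  refine ext_inner_left ℝ fun e => ?_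
  rw [inner_zero_right, ← integral_inner
    (hG.2.1.integrable_smul_left_of_hasCompactSupport hφ.continuous hc)]
  have := hG.2.2 φ hφ hc e
  rw [h e, eq_comm, neg_eq_zero] at this
  rw [← this]
  refine integral_congr_ae (.of_forall fun x => ?_)
  simp only
  rw [real_inner_smul_right, real_inner_comm, mul_comm]

theorem IsWeakGradient.ae_eq {u : EuclideanSpace ℝ (Fin n) → ℝ}
    {G G' : EuclideanSpace ℝ (Fin n) → EuclideanSpace ℝ (Fin n)} (hG : IsWeakGradient u G)
    (hG' : IsWeakGradient u G') : G =ᵐ[volume] G' := by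
  refine ae_eq_of_integral_contDiff_smul_eq hG.2.1 hG'.2.1 fun φ hφ hc => ?_
  refine ext_inner_left ℝ fun e => ?_
  rw [← integral_inner (hG.2.1.integrable_smul_left_of_hasCompactSupport hφ.continuous hc),
    ← integral_inner (hG'.2.1.integrable_smul_left_of_hasCompactSupport hφ.continuous hc)]
  have h1 := hG.2.2 φ hφ hc e
  rw [hG'.2.2 φ hφ hc e, neg_inj] at h1
  simp_rw [real_inner_smul_right, real_inner_comm _ e, mul_comm (φ _)]
  simpa [real_inner_comm] using h1.symm

theorem IsWeakGradient.weakGradient_ae_eq {u : EuclideanSpace ℝ (Fin n) → ℝ}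
    {G : EuclideanSpace ℝ (Fin n) → EuclideanSpace ℝ (Fin n)} (hG : IsWeakGradient u G) :
    weakGradient u =ᵐ[volume] G := by
  have h : ∃ G, IsWeakGradient u G := ⟨G, hG⟩
  rw [weakGradient, dif_pos h]
  exact h.choose_spec.ae_eq hG

/-- The weak gradient vanishes almost everywhere where the function vanishes, on the complement of an
open set with null frontier. -/
theorem IsWeakGradient.ae_eq_zero_of_compl {u : EuclideanSpace ℝ (Fin n) → ℝ}
    {G : EuclideanSpace ℝ (Fin n) → EuclideanSpace ℝ (Fin n)} (hG : IsWeakGradient u G)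
    {Ω : Set (EuclideanSpace ℝ (Fin n))} (hΩo : IsOpen Ω) (hΩ : volume (frontier Ω) = 0)
    (hu : ∀ᵐ x ∂(volume.restrict Ωᶜ), u x = 0) : ∀ᵐ x, x ∉ Ω → G x = 0 := by
  rw [ae_restrict_iff' hΩo.measurableSet.compl] at hu
  -- A test function supported off the closure has zero derivative on `Ω`, while `u` vanishes
  -- elsewhere, so its pairing with `G` is zero.
  have hout := isClosed_closure.isOpen_compl (s := closure Ω)
    |>.ae_eq_zero_of_integral_contDiff_smul_eq_zero (μ := volume) (f := G)
    (hG.2.1.locallyIntegrableOn _) (fun φ hφ hc hsupp => by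
      refine hG.integral_smul_eq_zero_of_test hφ hc fun e => ?_
      refine integral_eq_zero_of_ae ?_
      filter_upwards [hu] with x hx
      by_cases hxΩ : x ∈ Ω
      · have : x ∉ tsupport φ := fun h => hsupp h (subset_closure hxΩ)
        have h0 : fderiv ℝ φ x = 0 := by
          by_contra hne
          exact this (support_fderiv_subset ℝ hne)
        simp [h0]
      · simp [hx hxΩ])
  filter_upwards [hout, measure_eq_zero_iff_ae_notMem.1 hΩ] with x h1 h2 h3
  refine h1 fun hcl => h2 ?_
  rw [hΩo.frontier_eq]
  exact ⟨hcl, h3⟩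

/-! ### Finiteness of the fractional energy -/

/-- An integrable radial majorant of the translation energy weighted by the fractional kernel. -/
theorem integrable_min_one_sq_div_rpow (hn : 1 ≤ n) {s : ℝ} (hs0 : 0 < s) (hs1 : s < 1) :
    Integrable (fun h : EuclideanSpace ℝ (Fin n) =>
      min 1 (‖h‖ ^ 2) / ‖h‖ ^ ((n : ℝ) + 2 * s)) volume := by
  have : Nonempty (Fin n) := ⟨⟨0, hn⟩⟩
  have : Nontrivial (EuclideanSpace ℝ (Fin n)) := inferInstance
  rw [integrable_fun_norm_addHaar (μ := volume)
    (f := fun r : ℝ => min 1 (r ^ 2) / r ^ ((n : ℝ) + 2 * s)), ← Ioc_union_Ioi_eq_Ioi zero_le_one]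
  have hpow : ∀ y : ℝ, 0 < y → y ^ (n - 1) = y ^ ((n : ℝ) - 1) := fun y hy => by
    rw [← Real.rpow_natCast, Nat.cast_sub hn, Nat.cast_one]
  refine IntegrableOn.union ?_ ?_
  -- In polar coordinates the exponent is `1 - 2s` near the origin, where `s < 1` is needed, and `-1
  -- - 2s` at infinity, where `0 < s` is needed.
  · have h1 : IntegrableOn (fun y : ℝ => y ^ (1 - 2 * s)) (Ioc 0 1) := by
      rw [← intervalIntegrable_iff_integrableOn_Ioc_of_le zero_le_one]
      exact intervalIntegral.intervalIntegrable_rpow' (by linarith)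
    refine h1.congr_fun (fun y hy => ?_) measurableSet_Ioc
    have hy0 : 0 < y := hy.1
    simp only [finrank_euclideanSpace_fin, smul_eq_mul]
    rw [min_eq_right (pow_le_one₀ hy0.le hy.2), hpow y hy0, ← Real.rpow_natCast y 2,
      ← Real.rpow_sub hy0, ← Real.rpow_add hy0]
    congr 1
    push_cast
    ring
  · have h1 : IntegrableOn (fun y : ℝ => y ^ (-1 - 2 * s)) (Ioi 1) :=
      integrableOn_Ioi_rpow_of_lt (by linarith) zero_lt_one
    refine h1.congr_fun (fun y hy => ?_) measurableSet_Ioi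
    have hy1 : 1 < y := hy
    have hy0 : 0 < y := by linarith
    simp only [finrank_euclideanSpace_fin, smul_eq_mul]
    rw [min_eq_left (one_le_pow₀ hy1.le), hpow y hy0, one_div, ← Real.rpow_neg hy0.le,
      ← Real.rpow_add hy0]
    congr 1
    ring

theorem integral_inner_sq_le {G : EuclideanSpace ℝ (Fin n) → EuclideanSpace ℝ (Fin n)}
    (hG2 : MemLp G 2 volume) (h : EuclideanSpace ℝ (Fin n)) :
    ∫ x, inner ℝ (G x) h ^ 2 ≤ (∫ x, ‖G x‖ ^ 2) * ‖h‖ ^ 2 := by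
  have hGn := (memLp_two_iff_integrable_sq_norm hG2.1).1 hG2
  rw [← integral_mul_const]
  refine integral_mono (hG2.inner_const h).integrable_sq (hGn.mul_const _) fun x => ?_
  simp only
  rw [← mul_pow, ← sq_abs]
  exact pow_le_pow_left₀ (abs_nonneg _) (abs_real_inner_le_norm _ _) 2

/-- `H¹` functions have finite Gagliardo seminorm. -/
theorem IsWeakGradient.integrable_gagliardo (hn : 1 ≤ n) {s : ℝ} (hs0 : 0 < s) (hs1 : s < 1)
    {u : EuclideanSpace ℝ (Fin n) → ℝ}
    {G : EuclideanSpace ℝ (Fin n) → EuclideanSpace ℝ (Fin n)} (hG : IsWeakGradient u G)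
    (hu2 : MemLp u 2 volume) (hG2 : MemLp G 2 volume) :
    Integrable (fun p : EuclideanSpace ℝ (Fin n) × EuclideanSpace ℝ (Fin n) =>
      (u p.1 - u p.2) * (u p.1 - u p.2) / ‖p.1 - p.2‖ ^ ((n : ℝ) + 2 * s)) volume := by
  set K : EuclideanSpace ℝ (Fin n) × EuclideanSpace ℝ (Fin n) → ℝ := fun p =>
    (u p.1 - u p.2) * (u p.1 - u p.2) / ‖p.1 - p.2‖ ^ ((n : ℝ) + 2 * s) with hK
  have hKm : AEStronglyMeasurable K (volume.prod volume) := by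
    have h1 : AEStronglyMeasurable (fun p : EuclideanSpace ℝ (Fin n) × EuclideanSpace ℝ (Fin n)
        => u p.1 - u p.2) (volume.prod volume) := hu2.1.comp_fst.sub hu2.1.comp_snd
    exact ((h1.mul h1).aemeasurable.div
      (Measurable.pow_const (by fun_prop) _).aemeasurable).aestronglyMeasurable
  -- The substitution `(h, x) ↦ (x, x + h)` makes the double integral a weighted integral of
  -- translation energies.
  have hmp := measurePreserving_prod_add_swap
    (volume : Measure (EuclideanSpace ℝ (Fin n))) (volume : Measure (EuclideanSpace ℝ (Fin n)))
  rw [Measure.volume_eq_prod, ← hmp.integrable_comp hKm]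
  have hKc : ∀ h x, (K ∘ fun z : EuclideanSpace ℝ (Fin n) × EuclideanSpace ℝ (Fin n) =>
      (z.2, z.2 + z.1)) (h, x) = (u (x + h) - u x) ^ 2 / ‖h‖ ^ ((n : ℝ) + 2 * s) := fun h x => by
    simp only [hK, Function.comp_apply]
    rw [show x - (x + h) = -h by abel, norm_neg]
    ring
  have hmeas := hKm.comp_measurePreserving hmp
  have hint : ∀ h, Integrable (fun x => (u (x + h) - u x) ^ 2) volume := fun h =>
    ((memLp_translate hu2 h).sub hu2).integrable_sq
  rw [integrable_prod_iff hmeas]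
  refine ⟨.of_forall fun h => ?_, ?_⟩
  · simp_rw [hKc]
    exact (hint h).div_const _
  -- The first summand serves the trivial bound for large `h`, the second the gradient bound for
  -- small `h`.
  set C : ℝ := 4 * (∫ x, u x ^ 2) + ∫ x, ‖G x‖ ^ 2 with hC
  refine ((integrable_min_one_sq_div_rpow hn hs0 hs1).const_mul C).mono'
    hmeas.norm.integral_prod_right' (.of_forall fun h => ?_)
  simp_rw [hKc]
  have hu0 : 0 ≤ ∫ x, u x ^ 2 := integral_nonneg fun x => sq_nonneg _
  have hG0 : 0 ≤ ∫ x, ‖G x‖ ^ 2 := integral_nonneg fun x => sq_nonneg _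
  rw [Real.norm_eq_abs, abs_of_nonneg (integral_nonneg fun x => norm_nonneg _)]
  have hnn : ∀ x, ‖(u (x + h) - u x) ^ 2 / ‖h‖ ^ ((n : ℝ) + 2 * s)‖
      = (u (x + h) - u x) ^ 2 / ‖h‖ ^ ((n : ℝ) + 2 * s) := fun x => by
    rw [Real.norm_eq_abs, abs_of_nonneg (by positivity)]
  simp_rw [hnn]
  rw [integral_div, ← mul_div_assoc]
  refine div_le_div_of_nonneg_right ?_ (by positivity)
  rw [mul_min_of_nonneg _ _ (by positivity)]
  refine le_min ?_ ?_
  · have hut := (memLp_translate hu2 h).integrable_sq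
    calc ∫ x, (u (x + h) - u x) ^ 2 ≤ ∫ x, (2 * u (x + h) ^ 2 + 2 * u x ^ 2) := by
          refine integral_mono (hint h) ((hut.const_mul 2).add (hu2.integrable_sq.const_mul 2))
            fun x => ?_
          simp only
          nlinarith [sq_nonneg (u (x + h) + u x)]
      _ = 4 * ∫ x, u x ^ 2 := by
          rw [integral_add (hut.const_mul 2) (hu2.integrable_sq.const_mul 2), integral_const_mul,
            integral_const_mul, integral_add_right_eq_self (fun x => u x ^ 2) h]
          ring
      _ ≤ C * 1 := by
          rw [hC]
          linarith
  · calc ∫ x, (u (x + h) - u x) ^ 2 ≤ ∫ x, inner ℝ (G x) h ^ 2 :=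
          hG.integral_translate_sub_sq_le hu2 hG2 h
      _ ≤ (∫ x, ‖G x‖ ^ 2) * ‖h‖ ^ 2 := integral_inner_sq_le hG2 h
      _ ≤ C * ‖h‖ ^ 2 := by
          refine mul_le_mul_of_nonneg_right ?_ (by positivity)
          rw [hC]
          linarith

/-! ### Poincaré and Faber–Krahn inequalities -/

theorem eq_indicator_ae {w : EuclideanSpace ℝ (Fin n) → ℝ} {S : Set (EuclideanSpace ℝ (Fin n))}
    (hwS : ∀ᵐ x, x ∉ S → w x = 0) : (fun x => w x * S.indicator 1 x) =ᵐ[volume] w := by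
  filter_upwards [hwS] with x hx
  by_cases hxS : x ∈ S
  · simp [hxS]
  · simp [hx hxS]

theorem memLp_indicator_one {S : Set (EuclideanSpace ℝ (Fin n))} (hS : MeasurableSet S)
    (hSfin : volume S ≠ ⊤) : MemLp (S.indicator (1 : EuclideanSpace ℝ (Fin n) → ℝ)) 2 volume :=
  memLp_indicator_const 2 hS (1 : ℝ) (Or.inr hSfin)

/-- A Poincaré inequality on sets of small measure: it follows from averaging the translation
estimate over a ball of twice the measure. -/
theorem IsWeakGradient.integral_sq_le_of_support {w : EuclideanSpace ℝ (Fin n) → ℝ}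
    {G : EuclideanSpace ℝ (Fin n) → EuclideanSpace ℝ (Fin n)} (hG : IsWeakGradient w G)
    (hw2 : MemLp w 2 volume) (hG2 : MemLp G 2 volume) (hw0 : ∀ x, 0 ≤ w x)
    {S : Set (EuclideanSpace ℝ (Fin n))} (hS : MeasurableSet S) (hSfin : volume S ≠ ⊤)
    (hwS : ∀ᵐ x, x ∉ S → w x = 0) {r : ℝ} (hr : 0 < r)
    (hrS : 2 * volume.real S ≤ volume.real (Metric.ball (0 : EuclideanSpace ℝ (Fin n)) r)) :
    ∫ x, w x ^ 2 ≤ r ^ 2 * ∫ x, ‖G x‖ ^ 2 := by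
  have h1S := memLp_indicator_one hS hSfin
  have hwint : Integrable w volume := (hw2.integrable_mul h1S).congr (eq_indicator_ae hwS)
  have hL1 : (∫ x, w x) ^ 2 ≤ volume.real S * ∫ x, w x ^ 2 := by
    have h2 := abs_integral_mul_le_sqrt hw2 h1S
    rw [integral_congr_ae (eq_indicator_ae hwS)] at h2
    have h3 : ∫ x, S.indicator (1 : EuclideanSpace ℝ (Fin n) → ℝ) x ^ 2 = volume.real S := by
      rw [← integral_indicator_one hS]
      refine integral_congr_ae (.of_forall fun x => ?_)
      by_cases hx : x ∈ S <;> simp [hx]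
    rw [h3] at h2
    rw [← sq_abs]
    refine (pow_le_pow_left₀ (abs_nonneg _) h2 2).trans (le_of_eq ?_)
    rw [mul_pow, Real.sq_sqrt (integral_nonneg fun x => sq_nonneg _),
      Real.sq_sqrt measureReal_nonneg, mul_comm]
  -- The autocorrelation of `w`: it is nonnegative, has total integral `(∫ w)²`, and satisfies `‖w(·
  -- + h) - w‖₂² = 2‖w‖₂² - 2F(h)`.
  set F : EuclideanSpace ℝ (Fin n) → ℝ :=
    convolution (fun x => w (-x)) w (ContinuousLinearMap.mul ℝ ℝ) volume with hF
  have hwneg : Integrable (fun x => w (-x)) volume := hwint.comp_neg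
  have hFint : Integrable F volume :=
    hwneg.integrable_convolution (ContinuousLinearMap.mul ℝ ℝ) hwint
  have hFval : ∫ h, F h = (∫ x, w x) ^ 2 := by
    rw [hF, integral_convolution (ContinuousLinearMap.mul ℝ ℝ) hwneg hwint,
      integral_neg_eq_self w volume]
    simp [sq]
  have hFeq : ∀ h, F h = ∫ x, w (x + h) * w x := fun h => by
    rw [hF, convolution_def, ← integral_neg_eq_self]
    refine integral_congr_ae (.of_forall fun x => ?_)
    simp only [neg_neg, ContinuousLinearMap.mul_apply']
    rw [sub_neg_eq_add, add_comm h x, mul_comm]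
  have hF0 : ∀ h, 0 ≤ F h := fun h => by
    rw [hFeq]
    exact integral_nonneg fun x => mul_nonneg (hw0 _) (hw0 _)
  have hN0 : 0 ≤ ∫ x, w x ^ 2 := integral_nonneg fun x => sq_nonneg _
  have hE0 : 0 ≤ ∫ x, ‖G x‖ ^ 2 := integral_nonneg fun x => sq_nonneg _
  have hpt : ∀ h ∈ Metric.ball (0 : EuclideanSpace ℝ (Fin n)) r,
      2 * (∫ x, w x ^ 2) - r ^ 2 * (∫ x, ‖G x‖ ^ 2) ≤ 2 * F h := fun h hh => by
    have hwt := memLp_translate hw2 h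
    have h1 := (hG.integral_translate_sub_sq_le hw2 hG2 h).trans (integral_inner_sq_le hG2 h)
    have h2 : ∫ x, (w (x + h) - w x) ^ 2 = 2 * (∫ x, w x ^ 2) - 2 * F h := by
      have hp : Integrable (fun x => w (x + h) * w x) volume := hwt.integrable_mul hw2
      have : ∀ x, (w (x + h) - w x) ^ 2 = (w (x + h) ^ 2 + w x ^ 2) - 2 * (w (x + h) * w x) :=
        fun x => by ring
      simp_rw [this]
      have hadd : Integrable (fun x => w (x + h) ^ 2 + w x ^ 2) volume :=
        hwt.integrable_sq.add hw2.integrable_sq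
      rw [integral_sub hadd (hp.const_mul 2), integral_add hwt.integrable_sq hw2.integrable_sq,
        integral_const_mul, integral_add_right_eq_self (fun x => w x ^ 2) h, ← hFeq]
      ring
    have h3 : ‖h‖ ^ 2 ≤ r ^ 2 :=
      pow_le_pow_left₀ (norm_nonneg _) (mem_ball_zero_iff.1 hh).le 2
    nlinarith
  have hBfin : volume (Metric.ball (0 : EuclideanSpace ℝ (Fin n)) r) ≠ ⊤ := measure_ball_lt_top.ne
  have hBpos : 0 < volume.real (Metric.ball (0 : EuclideanSpace ℝ (Fin n)) r) :=
    ENNReal.toReal_pos (Metric.measure_ball_pos _ _ hr).ne' hBfin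
  have hball : volume.real (Metric.ball (0 : EuclideanSpace ℝ (Fin n)) r)
      * (2 * (∫ x, w x ^ 2) - r ^ 2 * (∫ x, ‖G x‖ ^ 2)) ≤ 2 * (∫ x, w x) ^ 2 := by
    calc _ = ∫ _ in Metric.ball (0 : EuclideanSpace ℝ (Fin n)) r,
          (2 * (∫ x, w x ^ 2) - r ^ 2 * (∫ x, ‖G x‖ ^ 2)) := by
          rw [setIntegral_const, smul_eq_mul]
      _ ≤ ∫ h in Metric.ball (0 : EuclideanSpace ℝ (Fin n)) r, 2 * F h :=
          setIntegral_mono_on (integrableOn_const hBfin) (hFint.const_mul 2).integrableOn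
            measurableSet_ball hpt
      _ ≤ ∫ h, 2 * F h := setIntegral_le_integral (hFint.const_mul 2)
            (.of_forall fun h => mul_nonneg zero_le_two (hF0 h))
      _ = _ := by rw [integral_const_mul, hFval]
  -- With `N = ∫ w²`, `E = ∫ |G|²` and `B` the ball, `|B| (2N - r²E) ≤ 2 (∫ w)² ≤ 2 |S| N ≤ |B| N`.
  refine le_of_mul_le_mul_left ?_ hBpos
  nlinarith [mul_le_mul_of_nonneg_right hrS hN0]

/-- A Faber–Krahn type inequality. -/
theorem exists_faber_krahn (hn : 1 ≤ n) : ∃ κ : ℝ, 0 < κ ∧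
    ∀ (w : EuclideanSpace ℝ (Fin n) → ℝ)
      (G : EuclideanSpace ℝ (Fin n) → EuclideanSpace ℝ (Fin n))
      (S : Set (EuclideanSpace ℝ (Fin n))), IsWeakGradient w G → MemLp w 2 volume →
      MemLp G 2 volume → (∀ x, 0 ≤ w x) → MeasurableSet S → volume S ≠ ⊤ →
      (∀ᵐ x, x ∉ S → w x = 0) →
      ∫ x, w x ^ 2 ≤ κ * volume.real S ^ (2 / (n : ℝ)) * ∫ x, ‖G x‖ ^ 2 := by
  set c := volume.real (Metric.ball (0 : EuclideanSpace ℝ (Fin n)) 1) with hc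
  have hc0 : 0 < c :=
    ENNReal.toReal_pos (Metric.measure_ball_pos _ _ one_pos).ne' measure_ball_lt_top.ne
  refine ⟨(2 / c) ^ (2 / (n : ℝ)), by positivity, fun w G S hG hw2 hG2 hw0 hS hSfin hwS => ?_⟩
  have hE0 : 0 ≤ ∫ x, ‖G x‖ ^ 2 := integral_nonneg fun x => sq_nonneg _
  have hn0 : (n : ℝ) ≠ 0 := by positivity
  rcases (measureReal_nonneg (μ := volume) (s := S)).eq_or_lt with h0 | hpos
  · have hnull : volume S = 0 := by
      rcases (ENNReal.toReal_eq_zero_iff _).1 h0.symm with h | h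
      · exact h
      · exact absurd h hSfin
    have : ∫ x, w x ^ 2 = 0 := by
      refine integral_eq_zero_of_ae ?_
      filter_upwards [hwS, measure_eq_zero_iff_ae_notMem.1 hnull] with x h1 h2
      simp [h1 h2]
    rw [this]
    positivity
  -- This radius gives the ball exactly twice the measure of `S`.
  · set r : ℝ := (2 * volume.real S / c) ^ (1 / (n : ℝ)) with hr
    have hr0 : 0 < r := by positivity
    have hrn : r ^ n = 2 * volume.real S / c := by
      rw [hr, one_div, Real.rpow_inv_natCast_pow (by positivity) (by omega)]
    have hr2 : r ^ 2 = (2 / c) ^ (2 / (n : ℝ)) * volume.real S ^ (2 / (n : ℝ)) := by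
      rw [← Real.mul_rpow (by positivity) (by positivity), hr, ← Real.rpow_natCast,
        ← Real.rpow_mul (by positivity)]
      congr 1
      · ring
      · push_cast
        ring
    rw [← hr2]
    refine hG.integral_sq_le_of_support hw2 hG2 hw0 hS hSfin hwS hr0 (le_of_eq ?_)
    rw [measureReal_def volume (Metric.ball _ r), Measure.addHaar_ball_of_pos _ _ hr0,
      finrank_euclideanSpace_fin, hrn, ENNReal.toReal_mul, ENNReal.toReal_ofReal (by positivity),
      ← measureReal_def, ← hc]
    field_simp

/-! ### Excess over a level and minimality -/

/-- The excess `(u - M)⁺` of `u` over the level `M`. -/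
def excess (u : EuclideanSpace ℝ (Fin n) → ℝ) (M : ℝ) (x : EuclideanSpace ℝ (Fin n)) : ℝ :=
  u x - min (u x) M

theorem excess_nonneg (u : EuclideanSpace ℝ (Fin n) → ℝ) (M : ℝ)
    (x : EuclideanSpace ℝ (Fin n)) : 0 ≤ excess u M x :=
  sub_nonneg.2 (min_le_left _ _)

theorem memLp_excess {u : EuclideanSpace ℝ (Fin n) → ℝ} (hu : MemLp u 2 volume) {M : ℝ}
    (hM : 0 ≤ M) : MemLp (excess u M) 2 volume :=
  hu.sub (memLp_min_const hu hM)

theorem antitoneOn_integral_excess_sq {u : EuclideanSpace ℝ (Fin n) → ℝ}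
    (hu : MemLp u 2 volume) {M₀ : ℝ} (hM₀ : 0 ≤ M₀) :
    AntitoneOn (fun M => ∫ x, excess u M x ^ 2) (Ici M₀) := by
  intro M hM M' hM' hMM'
  refine integral_mono (memLp_excess hu (hM₀.trans hM')).integrable_sq
    (memLp_excess hu (hM₀.trans hM)).integrable_sq fun x => ?_
  refine pow_le_pow_left₀ (excess_nonneg u M' x) ?_ 2
  exact sub_le_sub_left (min_le_min_left _ hMM') _

theorem quadForm_nonneg (s : ℝ) (Ω : Set (EuclideanSpace ℝ (Fin n)))
    (u : EuclideanSpace ℝ (Fin n) → ℝ) : 0 ≤ quadForm s Ω u :=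
  add_nonneg (integral_nonneg fun x => real_inner_self_nonneg)
    (integral_nonneg fun p => div_nonneg (mul_self_nonneg _) (by positivity))

theorem principalEigenvalue_nonneg (s : ℝ) (Ω : Set (EuclideanSpace ℝ (Fin n))) :
    0 ≤ principalEigenvalue s Ω := by
  refine Real.sInf_nonneg ?_
  rintro r ⟨u, -, -, rfl⟩
  exact div_nonneg (quadForm_nonneg s Ω u) (integral_nonneg fun x => sq_nonneg _)

theorem MemX.setIntegral_sq {Ω : Set (EuclideanSpace ℝ (Fin n))} (hΩo : IsOpen Ω)
    {u : EuclideanSpace ℝ (Fin n) → ℝ} (hu : MemX Ω u) :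
    ∫ x in Ω, u x ^ 2 = ∫ x, u x ^ 2 := by
  refine setIntegral_eq_integral_of_ae_compl_eq_zero ?_
  filter_upwards [(ae_restrict_iff' hΩo.measurableSet.compl).1 hu.2] with x hx hxΩ
  simp [hx hxΩ]

theorem MemX.principalEigenvalue_mul_le {Ω : Set (EuclideanSpace ℝ (Fin n))} (hΩo : IsOpen Ω)
    (s : ℝ) {v : EuclideanSpace ℝ (Fin n) → ℝ} (hv : MemX Ω v) :
    principalEigenvalue s Ω * ∫ x, v x ^ 2 ≤ quadForm s Ω v := by
  by_cases h0 : v =ᵐ[volume] 0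
  · have : ∫ x, v x ^ 2 = 0 := by
      refine integral_eq_zero_of_ae ?_
      filter_upwards [h0] with x hx
      simp [hx]
    rw [this, mul_zero]
    exact quadForm_nonneg s Ω v
  · have hne : ∫ x, v x ^ 2 ≠ 0 := fun hz => by
      rw [integral_eq_zero_iff_of_nonneg (fun x => sq_nonneg _) hv.1.1.integrable_sq] at hz
      refine h0 ?_
      filter_upwards [hz] with x hx
      simpa using hx
    have hpos : 0 < ∫ x, v x ^ 2 := lt_of_le_of_ne (integral_nonneg fun x => sq_nonneg _) hne.symm
    rw [← le_div_iff₀ hpos]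
    refine csInf_le ⟨0, ?_⟩ ⟨v, hv, h0, by rw [hv.setIntegral_sq hΩo]⟩
    rintro r ⟨u, -, -, rfl⟩
    exact div_nonneg (quadForm_nonneg s Ω u) (integral_nonneg fun x => sq_nonneg _)

/-- The local term may be taken over the whole space, where the energy splitting holds: the gradient
vanishes a.e. off `Ω` because the frontier is null. -/
theorem IsWeakGradient.quadForm_eq {u : EuclideanSpace ℝ (Fin n) → ℝ}
    {G : EuclideanSpace ℝ (Fin n) → EuclideanSpace ℝ (Fin n)} (hG : IsWeakGradient u G)
    (s : ℝ) {Ω : Set (EuclideanSpace ℝ (Fin n))} (hΩo : IsOpen Ω) (hΩ : HasC1Boundary Ω)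
    (hu : ∀ᵐ x ∂(volume.restrict Ωᶜ), u x = 0) :
    quadForm s Ω u = (∫ x, ‖G x‖ ^ 2) +
      ∫ p : EuclideanSpace ℝ (Fin n) × EuclideanSpace ℝ (Fin n),
        (u p.1 - u p.2) * (u p.1 - u p.2) / ‖p.1 - p.2‖ ^ ((n : ℝ) + 2 * s) := by
  rw [quadForm, bilinForm]
  congr 1
  rw [setIntegral_eq_integral_of_ae_compl_eq_zero]
  · refine integral_congr_ae ?_
    filter_upwards [hG.weakGradient_ae_eq] with x hx
    rw [hx, real_inner_self_eq_norm_sq]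
  · filter_upwards [hG.weakGradient_ae_eq,
      hG.ae_eq_zero_of_compl hΩo (hΩ.volume_frontier hΩo) hu] with x h1 h2 hx
    rw [h1, h2 hx, inner_zero_left]

/-- Minimality tested with the truncation `min u M`: the energy of the excess of a principal
eigenfunction is controlled by its lower order terms. -/
theorem IsPrincipalEigenfunction.exists_gradient_excess (hn : 1 ≤ n) {s : ℝ} (hs0 : 0 < s)
    (hs1 : s < 1) {Ω : Set (EuclideanSpace ℝ (Fin n))} (hΩo : IsOpen Ω) (hΩ : HasC1Boundary Ω)
    {u : EuclideanSpace ℝ (Fin n) → ℝ} (hu : IsPrincipalEigenfunction s Ω u) {M : ℝ}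
    (hM : 0 ≤ M) :
    ∃ G : EuclideanSpace ℝ (Fin n) → EuclideanSpace ℝ (Fin n), MemLp G 2 volume ∧
      IsWeakGradient (excess u M) G ∧
      ∫ x, ‖G x‖ ^ 2 ≤ principalEigenvalue s Ω * ∫ x, (u x ^ 2 - min (u x) M ^ 2) := by
  have hu2 : MemLp u 2 volume := hu.memX.1.1
  obtain ⟨G, hG2, hG⟩ := hu.memX.1.2
  have hv2 := memLp_min_const hu2 hM
  obtain ⟨Gv, Gw, hGv2, hGv, hGw2, hGw, henergy⟩ := exists_isWeakGradient_pair hG hu2 hG2 hv2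
    (memLp_excess hu2 hM) fun x y => truncation_increment_le (u x) (u y) M
  refine ⟨Gw, hGw2, hGw, ?_⟩
  have hvΩ : ∀ᵐ x ∂(volume.restrict Ωᶜ), min (u x) M = 0 := by
    filter_upwards [hu.memX.2] with x hx
    rw [hx, min_eq_left hM]
  have hvX : MemX Ω (fun x => min (u x) M) := ⟨⟨hv2, Gv, hGv2, hGv⟩, hvΩ⟩
  have hmin := hvX.principalEigenvalue_mul_le hΩo s
  rw [hGv.quadForm_eq s hΩo hΩ hvΩ] at hmin
  have hnorm : ∫ x, u x ^ 2 = 1 := by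
    rw [← hu.memX.setIntegral_sq hΩo]
    have hr := hu2.restrict Ω
    have h1 := norm_toLp_sq hr
    rw [Lp.norm_toLp, hu.norm_eq_one] at h1
    simpa using h1.symm
  have heig : principalEigenvalue s Ω * ∫ x, u x ^ 2 = _ :=
    (by rw [hnorm, mul_one, hu.quadForm_eq]
      : principalEigenvalue s Ω * ∫ x, u x ^ 2 = quadForm s Ω u).trans
      (hG.quadForm_eq s hΩo hΩ hu.memX.2)
  have hgag : ∫ p : EuclideanSpace ℝ (Fin n) × EuclideanSpace ℝ (Fin n),
      (min (u p.1) M - min (u p.2) M) * (min (u p.1) M - min (u p.2) M)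
        / ‖p.1 - p.2‖ ^ ((n : ℝ) + 2 * s)
      ≤ ∫ p : EuclideanSpace ℝ (Fin n) × EuclideanSpace ℝ (Fin n),
        (u p.1 - u p.2) * (u p.1 - u p.2) / ‖p.1 - p.2‖ ^ ((n : ℝ) + 2 * s) := by
    refine integral_mono_of_nonneg
      (.of_forall fun p => div_nonneg (mul_self_nonneg _) (by positivity))
      (hG.integrable_gagliardo hn hs0 hs1 hu2 hG2) (.of_forall fun p => ?_)
    refine div_le_div_of_nonneg_right ?_ (by positivity)
    have := truncation_increment_le (u p.1) (u p.2) M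
    nlinarith [sq_nonneg ((u p.1 - min (u p.1) M) - (u p.2 - min (u p.2) M))]
  -- Subtracting the inequality for `v` from the equality for `u`, the nonlocal difference is
  -- nonnegative and is dropped; the local one dominates `∫ |Gw|²`.
  rw [integral_sub hu2.integrable_sq hv2.integrable_sq, mul_sub]
  linarith

/-! ### Level sets and boundedness -/

theorem measureReal_mul_le_integral {f : EuclideanSpace ℝ (Fin n) → ℝ}
    (hf : Integrable f volume) (hf0 : ∀ x, 0 ≤ f x) {S : Set (EuclideanSpace ℝ (Fin n))} {c : ℝ}
    (hc : 0 < c) (hS : ∀ᵐ x, x ∈ S → c ≤ f x) :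
    volume S ≠ ⊤ ∧ c * volume.real S ≤ ∫ x, f x := by
  have hle : volume S ≤ volume {x | c ≤ f x} := measure_mono_ae hS
  have hfin : volume {x | c ≤ f x} < ⊤ := by
    refine lt_of_le_of_lt (measure_mono fun x hx => ?_) (hf.measure_norm_ge_lt_top hc)
    exact (show c ≤ f x from hx).trans (Real.le_norm_self _)
  refine ⟨(hle.trans_lt hfin).ne, ?_⟩
  refine le_trans ?_ (mul_meas_ge_le_integral_of_nonneg (.of_forall hf0) hf c)
  exact mul_le_mul_of_nonneg_left (ENNReal.toReal_mono hfin.ne hle) hc.le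

/-- The Caccioppoli type inequality of `exists_gradient_excess` makes a function bounded above. -/
theorem exists_ae_le_of_gradient_excess (hn : 1 ≤ n) {u : EuclideanSpace ℝ (Fin n) → ℝ}
    (hu2 : MemLp u 2 volume) {l : ℝ} (hl : 0 < l)
    (h : ∀ M, 0 ≤ M → ∃ G : EuclideanSpace ℝ (Fin n) → EuclideanSpace ℝ (Fin n),
      MemLp G 2 volume ∧ IsWeakGradient (excess u M) G ∧
      ∫ x, ‖G x‖ ^ 2 ≤ l * ∫ x, (u x ^ 2 - min (u x) M ^ 2)) :
    ∃ K, ∀ᵐ x, u x ≤ K := by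
  obtain ⟨κ, hκ, hFK⟩ := exists_faber_krahn hn
  set δ : ℝ := 2 / (n : ℝ) with hδ
  have hδ0 : 0 < δ := by positivity
  -- A measurable representative makes the superlevel sets measurable; they agree a.e. with those of
  -- `u`.
  set S : ℝ → Set (EuclideanSpace ℝ (Fin n)) := fun M => {x | M < hu2.1.mk u x} with hS
  have hSm : ∀ M, MeasurableSet (S M) := fun M =>
    measurableSet_lt measurable_const hu2.1.stronglyMeasurable_mk.measurable
  have hSu : ∀ M, ∀ᵐ x, x ∈ S M ↔ M < u x := fun M => by
    filter_upwards [hu2.1.ae_eq_mk] with x hx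
    simp only [hS, mem_ofPred_eq]
    rw [hx]
  set m : ℝ → ℝ := fun M => volume.real (S M) with hm
  set I : ℝ := ∫ x, u x ^ 2 with hI
  have hI0 : 0 ≤ I := integral_nonneg fun x => sq_nonneg _
  have hcheb : ∀ M, 0 < M → volume (S M) ≠ ⊤ ∧ M ^ 2 * m M ≤ I := fun M hM => by
    refine measureReal_mul_le_integral hu2.integrable_sq (fun x => sq_nonneg _) (by positivity) ?_
    filter_upwards [hSu M] with x hx hxS
    exact pow_le_pow_left₀ hM.le (hx.1 hxS).le 2
  have hcheb' : ∀ M M', 0 ≤ M → M < M' →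
      (M' - M) ^ 2 * m M' ≤ ∫ x, excess u M x ^ 2 := fun M M' hM hMM' => by
    have hd : 0 < M' - M := sub_pos.2 hMM'
    refine (measureReal_mul_le_integral (memLp_excess hu2 hM).integrable_sq
      (fun x => sq_nonneg _) (by positivity) ?_).2
    filter_upwards [hSu M'] with x hx hxS
    refine pow_le_pow_left₀ hd.le ?_ 2
    have := hx.1 hxS
    rw [excess, min_eq_right (hMM'.le.trans this.le)]
    linarith
  have hbase : ∀ M, 0 < M → ∫ x, excess u M x ^ 2
      ≤ κ * m M ^ δ * (l * (2 * (∫ x, excess u M x ^ 2) + M ^ 2 * m M)) := fun M hM => by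
    obtain ⟨G, hG2, hG, hGle⟩ := h M hM.le
    have hw2 := memLp_excess hu2 hM.le
    refine (hFK _ G (S M) hG hw2 hG2 (excess_nonneg u M) (hSm M) (hcheb M hM).1 ?_).trans ?_
    · filter_upwards [hSu M] with x hx hxS
      rw [excess, min_eq_left (not_lt.1 fun hlt => hxS (hx.2 hlt)), sub_self]
    refine mul_le_mul_of_nonneg_left (hGle.trans (mul_le_mul_of_nonneg_left ?_ hl.le))
      (by positivity)
    have hind : Integrable ((S M).indicator (1 : EuclideanSpace ℝ (Fin n) → ℝ)) volume :=
      (integrable_indicator_iff (hSm M)).2 (integrableOn_const (hcheb M hM).1)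
    rw [← integral_const_mul, show m M = volume.real (S M) from rfl,
      ← integral_indicator_one (hSm M), ← integral_const_mul,
      ← integral_add (hw2.integrable_sq.const_mul 2) (hind.const_mul _)]
    refine integral_mono_ae (hu2.integrable_sq.sub (memLp_min_const hu2 hM.le).integrable_sq)
      ((hw2.integrable_sq.const_mul 2).add (hind.const_mul _)) ?_
    filter_upwards [hSu M] with x hx
    by_cases hxS : x ∈ S M
    · have hlt := hx.1 hxS
      simp only [excess, min_eq_right hlt.le, indicator_of_mem hxS, Pi.one_apply]
      -- The right side minus the left side is `(u - 2M)²`.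
      nlinarith [sq_nonneg (u x - M - M)]
    · have hle : u x ≤ M := not_lt.1 fun hlt => hxS (hx.2 hlt)
      simp [excess, min_eq_left hle, hxS]
  -- Beyond `M₀`, Chebyshev makes the superlevel sets so small that the `∫ w²` term in `hbase` has
  -- coefficient at most `1/2` and is absorbed on the left.
  obtain ⟨M₀, hM₀, hM₀s⟩ : ∃ M₀ : ℝ, 0 < M₀ ∧ κ * (I / M₀ ^ 2) ^ δ * (2 * l) ≤ 1 / 2 := by
    have hlim : Tendsto (fun M : ℝ => κ * (I / M ^ 2) ^ δ * (2 * l)) atTop (𝓝 0) := by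
      have h1 : Tendsto (fun M : ℝ => I / M ^ 2) atTop (𝓝 0) :=
        tendsto_const_nhds.div_atTop (tendsto_pow_atTop two_ne_zero)
      have h2 := (h1.rpow_const (p := δ) (Or.inr hδ0.le)).const_mul κ |>.mul_const (2 * l)
      rwa [Real.zero_rpow hδ0.ne', mul_zero, zero_mul] at h2
    obtain ⟨M₀, h1, h2⟩ :=
      ((hlim.eventually_lt_const (by norm_num : (0 : ℝ) < 1 / 2)).and (eventually_gt_atTop 0)).exists
    exact ⟨M₀, h2, h1.le⟩
  have ha0 : ∀ M, 0 ≤ ∫ x, excess u M x ^ 2 := fun M => integral_nonneg fun x => sq_nonneg _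
  have hm0 : ∀ M, 0 ≤ m M := fun M => measureReal_nonneg
  obtain ⟨K, hK, hKz⟩ := exists_level_eq_zero (antitoneOn_integral_excess_sq hu2 hM₀.le) ha0
    (C := 2 * κ * l) (δ := δ) (by positivity) hδ0 hM₀ fun M M' hM hMM' => by
      have hM'0 : 0 < M' := hM₀.trans_le (hM.trans hMM'.le)
      have hmI : m M' ≤ I / M₀ ^ 2 := by
        rw [le_div_iff₀ (by positivity), mul_comm]
        refine le_trans ?_ (hcheb M' hM'0).2
        exact mul_le_mul_of_nonneg_right
          (pow_le_pow_left₀ hM₀.le (hM.trans hMM'.le) 2) (hm0 _)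
      have h1 : κ * m M' ^ δ * (2 * l) ≤ 1 / 2 := by
        refine le_trans ?_ hM₀s
        have := Real.rpow_le_rpow (hm0 M') hmI hδ0.le
        gcongr
      have h2 := hbase M' hM'0
      have h3 : ∫ x, excess u M' x ^ 2 ≤ 2 * κ * l * M' ^ 2 * (m M') ^ (1 + δ) := by
        rw [Real.rpow_one_add' (hm0 _) (by positivity)]
        nlinarith [mul_le_mul_of_nonneg_right h1 (ha0 M')]
      refine h3.trans ?_
      have h4 : m M' ≤ (∫ x, excess u M x ^ 2) / (M' - M) ^ 2 := by
        rw [le_div_iff₀ (pow_pos (sub_pos.2 hMM') 2), mul_comm]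
        exact hcheb' M M' (hM₀.le.trans hM) hMM'
      exact mul_le_mul_of_nonneg_left (Real.rpow_le_rpow (hm0 _) h4 (by positivity))
        (by positivity)
  refine ⟨K, ?_⟩
  rw [integral_eq_zero_iff_of_nonneg (fun x => sq_nonneg _)
    (memLp_excess hu2 (hM₀.le.trans hK)).integrable_sq] at hKz
  filter_upwards [hKz] with x hx
  have : excess u K x = 0 := by simpa using hx
  rw [excess, sub_eq_zero] at this
  rw [this]
  exact min_le_right _ _

end MixedOperator

end

theorem theorem3p3 (n : ℕ) (hn : 1 ≤ n) (s : ℝ) (hs0 : 0 < s) (hs1 : s < 1)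
    (Ω : Set (EuclideanSpace ℝ (Fin n))) (hΩo : IsOpen Ω) (hΩb : Bornology.IsBounded Ω)
    (hΩ : MixedOperator.HasC1Boundary Ω)
    (u₀ : EuclideanSpace ℝ (Fin n) → ℝ)
    (hu₀ : MixedOperator.IsPrincipalEigenfunction s Ω u₀) :
    MemLp u₀ ∞ (volume.restrict Ω) := by
  have hu2 : MemLp u₀ 2 volume := hu₀.memX.1.1
  obtain ⟨K, hK⟩ := MixedOperator.exists_ae_le_of_gradient_excess hn hu2
    -- The eigenvalue is only known here to be nonnegative; adding `1` makes the constant positive.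
    (l := MixedOperator.principalEigenvalue s Ω + 1)
    (by linarith [MixedOperator.principalEigenvalue_nonneg s Ω]) fun M hM => by
      obtain ⟨G, hG2, hG, hle⟩ := hu₀.exists_gradient_excess hn hs0 hs1 hΩo hΩ hM
      refine ⟨G, hG2, hG, hle.trans (mul_le_mul_of_nonneg_right (by linarith) ?_)⟩
      refine integral_nonneg fun x => ?_
      simp only [Pi.zero_apply]
      rcases le_total (u₀ x) M with h | h
      · rw [min_eq_left h, sub_self]
      · rw [min_eq_right h]
        nlinarith
  refine memLp_top_of_bound hu2.1.restrict K ?_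
  filter_upwards [hu₀.nonneg, ae_restrict_of_ae hK] with x h1 h2
  rwa [Real.norm_eq_abs, abs_of_nonneg h1]
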